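/- All algebras are nonempty. A partial function on a set $X$ is a set $f\subseteq X\times X$ such that $(x,y),(x,z)\in f$ implies $y=z$; its domain is $\mathrm{dom}(f)=\{x:\exists y\ (x,y)\in f\}$. Consider the following binary operations on partial functions: - antidomain restriction: $f\triangleright g=\{(x,y)\in g: x\notin\mathrm{dom}(f)\}$; - intersection: $f\wedge g=f\cap g$; - update: $f[g]=\{(x,y)\in f: x\notin\mathrm{dom}(g)\}\cup\{(x,y)\in g: x\in\mathrm{dom}(f)\}$; - preferential union: $f\sqcup g=f\cup\{(x,y)\in g: x\notin\mathrm{dom}(f)\}$. Let $\sigma$ be a signature consisting of $\triangleright$ and any of the other three operation symbols. A representation of a $\sigma$-algebra $\mathfrak A$ by partial functions is an isomorphism $\theta$ from $\mathfrak A$ to a $\sigma$-algebra whose elements are partial functions on some set and whose operations are the ones above; $\mathfrak A$ is representable if it has a representation. On a $\sigma$-algebra put $a\le b$ if and only if $(a\triangleright b)\triangleright b=a$; when the algebra is representable this is a partial order, with least element $0=a\triangleright a$ for every $a$. A representation $\theta$ is meet complete if $\theta(\bigwedge S)=\bigcap_{s\in S}\theta(s)$ for every nonempty set $S$ of elements whose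 meet exists, and join complete if $\theta(\bigvee S)=\bigcup_{s\in S}\theta(s)$ for every set $S$ of elements whose join exists. The algebra is meet-completely (respectively join-completely) representable if it has a meet-complete (respectively join-complete) representation. An atom is a minimal nonzero element, and the atoms are separating if whenever $a\not\le b$ there is an atom $c$ with $c\le a$ and $c\not\le b$. **Theorem.** For every signature $\sigma$ with $\{\triangleright\}\subseteq\sigma\subseteq\{\triangleright,\wedge,\text{update},\text{preferential union}\}$, the class of meet-completely representable $\sigma$-algebras is a basic elementary class, axiomatised by a single universal-existential-universal first-order sentence $\varphi$. If $\wedge\in\sigma$, then $\varphi$ also axiomatises the class of join-completely representable $\sigma$-algebras. Moreover, there is a finite set $Q$ of quasiequations that axiomatises the class of representable $\sigma$-algebras, and a $\sigma$-algebra satisfies $\varphi$ if and only if it satisfies $Q$ and its atoms are separating. -/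

import Mathlib

open FirstOrder

universe u

namespace PartialFunctionAlgebra

/-! ### Signatures -/

/-- The four binary operation symbols: antidomain restriction, intersection, update and
preferential union. -/
inductive Op : Type
  | antiRestrict
  | inter
  | update
  | prefUnion

/-- The function symbols of a signature `σ`: the members of `σ`, all of arity two. -/
inductive Symb (σ : Set Op) : ℕ → Type
  | bin (o : Op) (h : o ∈ σ) : Symb σ 2

/-- The algebraic first-order language with set of (binary) operation symbols `σ`. -/
def lang (σ : Set Op) : FirstOrder.Language.{0, 0} where
  Functions := Symb σ
  Relations := fun _ => Empty

instance (σ : Set Op) : (lang σ).IsAlgebraic := fun _ => inferInstanceAs (IsEmpty Empty)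

/-- The function symbol of the language `lang σ` given by `o ∈ σ`. -/
def symb {σ : Set Op} {o : Op} (h : o ∈ σ) : (lang σ).Functions 2 := Symb.bin o h

/-- The interpretation in a `σ`-algebra `A` of an operation symbol `o ∈ σ`. -/
def op {σ : Set Op} {A : Type u} [(lang σ).Structure A] {o : Op} (h : o ∈ σ) (a b : A) : A :=
  FirstOrder.Language.Structure.funMap (symb h) ![a, b]

/-! ### Partial functions -/

/-- A partial function on `X`: a subset `f` of `X × X` such that `(x, y) ∈ f` and `(x, z) ∈ f`
imply `y = z`. -/
@[ext]
structure PartialFunction (X : Type u) : Type u where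
  graph : SetRel X X
  functional : ∀ x y z, (x, y) ∈ graph → (x, z) ∈ graph → y = z

namespace PartialFunction

variable {X : Type u}

/-- Antidomain restriction: the restriction of `g` to the points at which `f` is undefined. -/
def antiRestrict (f g : PartialFunction X) : PartialFunction X where
  graph := {p | p.1 ∉ f.graph.dom ∧ p ∈ g.graph}
  functional := fun x y z h h' => g.functional x y z h.2 h'.2

/-- Intersection. -/
def inter (f g : PartialFunction X) : PartialFunction X where
  graph := f.graph ∩ g.graph
  functional := fun x y z h h' => g.functional x y z h.2 h'.2

/-- Update `f[g]`: it is defined exactly where `f` is, with the value of `g` where `g` is also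
defined, and with the value of `f` elsewhere. -/
def update (f g : PartialFunction X) : PartialFunction X where
  graph := {p | (p ∈ f.graph ∧ p.1 ∉ g.graph.dom) ∨ (p.1 ∈ f.graph.dom ∧ p ∈ g.graph)}
  functional := by
    rintro x y z (⟨h, k⟩ | ⟨h, k⟩) (⟨h', k'⟩ | ⟨h', k'⟩)
    · exact f.functional x y z h h'
    · exact absurd ⟨z, k'⟩ k
    · exact absurd ⟨y, k⟩ k'
    · exact g.functional x y z k k'

/-- Preferential union: `f` where `f` is defined, and `g` elsewhere. -/
def prefUnion (f g : PartialFunction X) : PartialFunction X where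
  graph := {p | p ∈ f.graph ∨ (p.1 ∉ f.graph.dom ∧ p ∈ g.graph)}
  functional := by
    rintro x y z (h | ⟨h, k⟩) (h' | ⟨h', k'⟩)
    · exact f.functional x y z h h'
    · exact absurd ⟨y, h⟩ h'
    · exact absurd ⟨z, h'⟩ h
    · exact g.functional x y z k k'

/-- The operation on partial functions denoted by an operation symbol. -/
def apply : Op → PartialFunction X → PartialFunction X → PartialFunction X
  | .antiRestrict => antiRestrict
  | .inter => inter
  | .update => update
  | .prefUnion => prefUnion

/-- The interpretation of a function symbol in the algebra of all partial functions on `X`. -/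
def interp {σ : Set Op} : ∀ {n}, Symb σ n → (Fin n → PartialFunction X) → PartialFunction X
  | _, .bin o _, v => apply o (v 0) (v 1)

/-- The `σ`-algebra of all partial functions on `X`. Its subalgebras are the `σ`-algebras of
partial functions with base contained in `X`; none of the operations depends on the base. -/
instance (σ : Set Op) : (lang σ).Structure (PartialFunction X) where
  funMap := fun s v => interp s v
  RelMap := fun r _ => isEmptyElim r

end PartialFunction

/-! ### Representations and complete representations -/

/-- A representation of a `σ`-algebra `A` by partial functions, with base contained in `X`: an
isomorphism from `A` to an algebra of partial functions, that is, an embedding of `A` into the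
algebra of all partial functions on `X`. -/
abbrev Representation (σ : Set Op) (A : Type u) [(lang σ).Structure A] (X : Type u) : Type u :=
  A ↪[lang σ] PartialFunction X

section Order

variable {σ : Set Op} (hσ : Op.antiRestrict ∈ σ) {A : Type u} [(lang σ).Structure A]

/-- Domain restriction, the term `(a ▷ b) ▷ b` in antidomain restriction `▷`. -/
def domRestrict (a b : A) : A := op hσ (op hσ a b) b

/-- The relation `≤` on a `σ`-algebra: `a ≤ b` iff the domain restriction of `b` to `a` is `a`. -/
@[reducible]
def algLE (A : Type u) [(lang σ).Structure A] : LE A := ⟨fun a b => domRestrict hσ a b = a⟩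

/-- Atoms: the minimal nonzero elements, where zero is given by the term `a ▷ a`. -/
def IsAtomElt (c : A) : Prop :=
  letI := algLE hσ A
  c ≠ op hσ c c ∧ ∀ b : A, b ≤ c → b ≠ op hσ b b → b = c

/-- The atoms are separating: if `a ≰ b` then there is an atom `c` with `c ≤ a` and `c ≰ b`. -/
def AtomsSeparating (A : Type u) [(lang σ).Structure A] : Prop :=
  letI := algLE hσ A
  ∀ a b : A, ¬ a ≤ b → ∃ c : A, IsAtomElt hσ c ∧ c ≤ a ∧ ¬ c ≤ b

/-- A representation is meet complete if it turns every existing meet of a nonempty set into an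
intersection. -/
def IsMeetComplete {X : Type u} (θ : Representation σ A X) : Prop :=
  letI := algLE hσ A
  ∀ (S : Set A) (m : A), S.Nonempty → IsGLB S m → (θ m).graph = ⋂ s ∈ S, (θ s).graph

/-- A representation is join complete if it turns every existing join into a union. -/
def IsJoinComplete {X : Type u} (θ : Representation σ A X) : Prop :=
  letI := algLE hσ A
  ∀ (S : Set A) (j : A), IsLUB S j → (θ j).graph = ⋃ s ∈ S, (θ s).graph

end Order

/-- `A` is representable by partial functions. -/
def Representable (σ : Set Op) (A : Type u) [(lang σ).Structure A] : Prop :=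
  ∃ X : Type u, Nonempty (Representation σ A X)

/-- `A` has a meet-complete representation by partial functions. -/
def MeetCompletelyRepresentable {σ : Set Op} (hσ : Op.antiRestrict ∈ σ)
    (A : Type u) [(lang σ).Structure A] : Prop :=
  ∃ (X : Type u) (θ : Representation σ A X), IsMeetComplete hσ θ

/-- `A` has a join-complete representation by partial functions. -/
def JoinCompletelyRepresentable {σ : Set Op} (hσ : Op.antiRestrict ∈ σ)
    (A : Type u) [(lang σ).Structure A] : Prop :=
  ∃ (X : Type u) (θ : Representation σ A X), IsJoinComplete hσ θ

/-! ### Syntax -/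

/-- A quasiequation: a finite list of equations (the premises, possibly none) and an equation (the
conclusion), between terms in variables indexed by `ℕ`. -/
structure Quasiequation (L : FirstOrder.Language.{0, 0}) : Type where
  premises : List (L.Term ℕ × L.Term ℕ)
  conclusion : L.Term ℕ × L.Term ℕ

/-- Validity of a quasiequation in an algebra: under every assignment of the variables at which
all the premises hold, the conclusion holds. -/
def Quasiequation.Holds {L : FirstOrder.Language.{0, 0}} (q : Quasiequation L)
    (A : Type u) [L.Structure A] : Prop :=
  ∀ v : ℕ → A, (∀ e ∈ q.premises, e.1.realize v = e.2.realize v) →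
    q.conclusion.1.realize v = q.conclusion.2.realize v

/-- Existential-universal formulas: a block of existential quantifiers applied to a universal
formula. -/
inductive IsExUniv {L : FirstOrder.Language.{0, 0}} {α : Type} : ∀ {n}, L.BoundedFormula α n → Prop
  | of_isUniversal {n : ℕ} {φ : L.BoundedFormula α n} (h : φ.IsUniversal) : IsExUniv φ
  | ex {n : ℕ} {φ : L.BoundedFormula α (n + 1)} (h : IsExUniv φ) : IsExUniv φ.ex

/-- Universal-existential-universal formulas: a block of universal quantifiers applied to an
existential-universal formula. -/
inductive IsUnivExUniv {L : FirstOrder.Language.{0, 0}} {α : Type} : ∀ {n}, L.BoundedFormula α n → Prop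
  | of_isExUniv {n : ℕ} {φ : L.BoundedFormula α n} (h : IsExUniv φ) : IsUnivExUniv φ
  | all {n : ℕ} {φ : L.BoundedFormula α (n + 1)} (h : IsUnivExUniv φ) : IsUnivExUniv φ.all

end PartialFunctionAlgebra

/-! A representation is a separating family of points, where a point evaluates every element at one
element of the base. Fix a point and read "`a` is undefined here" as "`a` is true": then `a ▷ b` is
the implication from `a` to `b`, and the zero elements are true. Representability thus becomes a
completeness theorem for implicational logic. A Zorn argument yields enough prime ideals, and at
each of them the elements take germs as values (`Axioms.exists_prime`, `Axioms.representable`). The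
other three operations need only axioms saying how they behave on and off a domain, since
`Axioms.isPoint` recovers them from `▷`.

For completeness, take a pair of the graph of `a` outside that of `b`. The elements below `a`
containing this pair have a nonzero lower bound when the representation is meet complete, and such a
bound is an atom. With intersection, a dual argument uses the elements below `a` that avoid the
point. Conversely, an atom `c` behaves like a single point: every domain contains or misses that of
`c`, so the restriction of `a` to the domain of `c` can serve as the value of `a` at `c`. Separating
atoms make this a representation, and it preserves both meets and joins
(`Representation.isMeetComplete_atomic`, `Representation.isJoinComplete_atomic`).

Separation of atoms is a ∀∃∀ condition and the axioms are universal, so one sentence expresses both.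
-/

namespace PartialFunctionAlgebra

/-! ### Partial functions as option-valued maps -/

/-- The operations on partial functions at a single point, where `none` means undefined. -/
noncomputable def flat {X : Type u} : Op → Option X → Option X → Option X
  | .antiRestrict, none, q => q
  | .antiRestrict, some _, _ => none
  | .inter, p, q => open Classical in if p = q then p else none
  | .update, none, _ => none
  | .update, some x, none => some x
  | .update, some _, some y => some y
  | .prefUnion, none, q => q
  | .prefUnion, some x, _ => some x

@[simp] lemma flat_none {X : Type u} (o : Op) : flat o (none : Option X) none = none := by
  cases o <;> simp [flat]

namespace PartialFunction

variable {X : Type u}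

/-- The partial function given by an option-valued map. -/
def ofFun (f : X → Option X) : PartialFunction X where
  graph := {p | f p.1 = some p.2}
  functional := fun _ _ _ h h' => Option.some_injective _ (h.symm.trans h')

open Classical in
/-- The value of a partial function at a point. -/
noncomputable def eval (f : PartialFunction X) (x : X) : Option X :=
  if h : ∃ y, (x, y) ∈ f.graph then some h.choose else none

lemma eval_eq_some {f : PartialFunction X} {x y : X} : f.eval x = some y ↔ (x, y) ∈ f.graph := by
  unfold eval
  split_ifs with h
  · rw [Option.some_inj]
    exact ⟨fun e => e ▸ h.choose_spec, fun e => f.functional _ _ _ h.choose_spec e⟩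
  · exact ⟨fun e => by simp at e, fun e => absurd ⟨y, e⟩ h⟩

lemma eval_eq_none {f : PartialFunction X} {x : X} : f.eval x = none ↔ x ∉ f.graph.dom := by
  rw [Option.eq_none_iff_forall_not_mem]
  simp [eval_eq_some, SetRel.dom]

lemma eval_ofFun (f : X → Option X) (x : X) : (ofFun f).eval x = f x :=
  Option.ext fun _ => eval_eq_some

lemma ext_eval {f g : PartialFunction X} (h : ∀ x, f.eval x = g.eval x) : f = g := by
  ext ⟨x, y⟩
  rw [← eval_eq_some, ← eval_eq_some, h]

lemma eval_apply (o : Op) (f g : PartialFunction X) (x : X) :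
    (apply o f g).eval x = flat o (f.eval x) (g.eval x) := by
  ext y
  rw [eval_eq_some]
  cases o
  · change (x ∉ f.graph.dom ∧ (x, y) ∈ g.graph) ↔ _
    rw [← eval_eq_none, ← eval_eq_some]
    cases f.eval x <;> simp [flat]
  · change ((x, y) ∈ f.graph ∧ (x, y) ∈ g.graph) ↔ _
    rw [← eval_eq_some, ← eval_eq_some]
    simp only [flat]
    split_ifs with h
    · simp [h]
    · simp only [iff_false, not_and]
      exact fun h₁ h₂ => h (h₁.trans h₂.symm)
  · change ((x, y) ∈ f.graph ∧ x ∉ g.graph.dom) ∨ (x ∈ f.graph.dom ∧ (x, y) ∈ g.graph) ↔ _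
    rw [← not_not (a := x ∈ f.graph.dom), ← eval_eq_none, ← eval_eq_none, ← eval_eq_some,
      ← eval_eq_some]
    cases f.eval x <;> cases g.eval x <;> simp [flat]
  · change ((x, y) ∈ f.graph ∨ (x ∉ f.graph.dom ∧ (x, y) ∈ g.graph)) ↔ _
    rw [← eval_eq_none, ← eval_eq_some, ← eval_eq_some]
    cases f.eval x <;> simp [flat]

end PartialFunction

/-! ### Representations as separating families of points -/

section Points

variable {σ : Set Op} {A : Type u} [(lang σ).Structure A] {X : Type u}

/-- A point of a `σ`-algebra: a homomorphism into the algebra of partial functions with values in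
`X` on a one-element domain. -/
def IsPoint (σ : Set Op) [(lang σ).Structure A] (h : A → Option X) : Prop :=
  ∀ (o : Op) (ho : o ∈ σ) (a b : A), h (op ho a b) = flat o (h a) (h b)

lemma Representation.isPoint (θ : Representation σ A X) (x : X) :
    IsPoint σ fun a => (θ a).eval x := by
  intro o ho a b
  rw [← PartialFunction.eval_apply]
  exact congrArg (fun f : PartialFunction X => f.eval x) (θ.map_fun (symb ho) ![a, b])

lemma Representation.eq_of_eval (θ : Representation σ A X) {a b : A}
    (h : ∀ x, (θ a).eval x = (θ b).eval x) : a = b :=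
  θ.injective (PartialFunction.ext_eval h)

/-- A separating family of points indexed by the base is a representation. -/
def Representation.ofPoints (h : X → A → Option X) (hp : ∀ x, IsPoint σ (h x))
    (hs : ∀ a b, (∀ x, h x a = h x b) → a = b) : Representation σ A X where
  toFun a := PartialFunction.ofFun fun x => h x a
  inj' a b e := hs a b fun x => by
    have := congrArg (fun f : PartialFunction X => f.eval x) e
    simpa only [PartialFunction.eval_ofFun] using this
  map_fun' := by
    rintro n ⟨o, ho⟩ v
    have hv : v = ![v 0, v 1] := by
      funext i
      fin_cases i <;> rfl
    rw [hv]
    refine PartialFunction.ext_eval fun x => ?_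
    rw [PartialFunction.eval_ofFun]
    refine (hp x o ho _ _).trans ?_
    refine Eq.trans ?_ (PartialFunction.eval_apply o _ _ x).symm
    simp [PartialFunction.eval_ofFun]
  map_rel' r := isEmptyElim r

end Points

/-! ### The axioms -/

/-- The quasiequations of the algebras of partial functions. -/
structure Axioms {σ : Set Op} (hσ : Op.antiRestrict ∈ σ) (A : Type u) [(lang σ).Structure A] :
    Prop where
  zero : ∀ a b : A, op hσ a a = op hσ b b
  anti_zero : ∀ a b : A, op hσ a (op hσ b b) = op hσ b b
  weaken : ∀ a b : A, op hσ a (op hσ b a) = op hσ a a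
  distrib : ∀ a b c : A, op hσ (op hσ a b) (op hσ a c) = op hσ a (op hσ b c)
  peirce : ∀ a b c : A, op hσ (op hσ a b) (domRestrict hσ (op hσ a c) b) = op hσ b b
  idem : ∀ a : A, domRestrict hσ a a = a
  anti_le : ∀ a b : A, domRestrict hσ (op hσ a b) b = op hσ a b
  assoc : ∀ a b c : A,
    domRestrict hσ (domRestrict hσ a b) c = domRestrict hσ a (domRestrict hσ b c)
  comm : ∀ a b c : A,
    domRestrict hσ a (domRestrict hσ b c) = domRestrict hσ b (domRestrict hσ a c)
  locality : ∀ a b c d : A, domRestrict hσ a c = domRestrict hσ a d →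
    domRestrict hσ (op hσ a b) c = domRestrict hσ (op hσ a b) d →
    domRestrict hσ b c = domRestrict hσ b d
  antisymm : ∀ a b : A, domRestrict hσ a b = a → domRestrict hσ b a = b → a = b
  inter_left : ∀ (h : Op.inter ∈ σ) (a b : A), domRestrict hσ (op h a b) a = op h a b
  inter_right : ∀ (h : Op.inter ∈ σ) (a b : A), domRestrict hσ (op h a b) b = op h a b
  inter_agree : ∀ (h : Op.inter ∈ σ) (a b c : A), domRestrict hσ c a = domRestrict hσ c b →
    domRestrict hσ c (op h a b) = domRestrict hσ c a
  update_on : ∀ (h : Op.update ∈ σ) (a b : A),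
    domRestrict hσ b (op h a b) = domRestrict hσ a b
  update_off : ∀ (h : Op.update ∈ σ) (a b : A), op hσ b (op h a b) = op hσ b a
  union_on : ∀ (h : Op.prefUnion ∈ σ) (a b : A), domRestrict hσ a (op h a b) = a
  union_off : ∀ (h : Op.prefUnion ∈ σ) (a b : A), op hσ a (op h a b) = op hσ a b

section

variable {σ : Set Op} {hσ : Op.antiRestrict ∈ σ} {A : Type u} [(lang σ).Structure A] {X : Type u}

lemma IsPoint.domRestrict {h : A → Option X} (hp : IsPoint σ h) (a b : A) :
    h (domRestrict hσ a b) = flat .antiRestrict (flat .antiRestrict (h a) (h b)) (h b) := by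
  unfold PartialFunctionAlgebra.domRestrict
  rw [hp, hp]

theorem Representation.axioms (hσ : Op.antiRestrict ∈ σ) (θ : Representation σ A X) :
    Axioms hσ A := by
  have key : ∀ {a b : A}, a = b ↔ ∀ x, (θ a).eval x = (θ b).eval x :=
    fun {a b} => ⟨fun e x => by rw [e], θ.eq_of_eval⟩
  have e₁ : ∀ (o : Op) (ho : o ∈ σ) (a b : A) (x : X),
      (θ (op ho a b)).eval x = flat o ((θ a).eval x) ((θ b).eval x) :=
    fun o ho a b x => θ.isPoint x o ho a b
  -- Every axiom is checked at one point, by cases on which elements are defined there.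
  constructor
  case zero =>
    intro a b
    rw [key]
    intro x
    simp only [e₁]
    cases (θ a).eval x <;> cases (θ b).eval x <;> simp [flat]
  case anti_zero =>
    intro a b
    rw [key]
    intro x
    simp only [e₁]
    cases (θ a).eval x <;> cases (θ b).eval x <;> simp [flat]
  case weaken =>
    intro a b
    rw [key]
    intro x
    simp only [e₁]
    cases (θ a).eval x <;> cases (θ b).eval x <;> simp [flat]
  case distrib =>
    intro a b c
    rw [key]
    intro x
    simp only [e₁]
    cases (θ a).eval x <;> cases (θ b).eval x <;> cases (θ c).eval x <;> simp [flat]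
  case peirce =>
    intro a b c
    rw [key]
    intro x
    simp only [domRestrict, e₁]
    cases (θ a).eval x <;> cases (θ b).eval x <;> cases (θ c).eval x <;> simp [flat]
  case idem =>
    intro a
    rw [key]
    intro x
    simp only [domRestrict, e₁]
    cases (θ a).eval x <;> simp [flat]
  case anti_le =>
    intro a b
    rw [key]
    intro x
    simp only [domRestrict, e₁]
    cases (θ a).eval x <;> cases (θ b).eval x <;> simp [flat]
  case assoc =>
    intro a b c
    rw [key]
    intro x
    simp only [domRestrict, e₁]
    cases (θ a).eval x <;> cases (θ b).eval x <;> cases (θ c).eval x <;> simp [flat]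
  case comm =>
    intro a b c
    rw [key]
    intro x
    simp only [domRestrict, e₁]
    cases (θ a).eval x <;> cases (θ b).eval x <;> cases (θ c).eval x <;> simp [flat]
  case locality =>
    intro a b c d h₁ h₂
    rw [key] at h₁ h₂ ⊢
    intro x
    replace h₁ := h₁ x
    replace h₂ := h₂ x
    revert h₁ h₂
    simp only [domRestrict, e₁]
    cases (θ a).eval x <;> cases (θ b).eval x <;> cases (θ c).eval x <;>
      cases (θ d).eval x <;> simp [flat]
  case antisymm =>
    intro a b h₁ h₂
    rw [key] at h₁ h₂ ⊢
    intro x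
    replace h₁ := h₁ x
    replace h₂ := h₂ x
    revert h₁ h₂
    simp only [domRestrict, e₁]
    cases (θ a).eval x <;> cases (θ b).eval x <;> simp +contextual [flat]
  case inter_left =>
    intro h a b
    rw [key]
    intro x
    simp only [domRestrict, e₁]
    cases (θ a).eval x <;> cases (θ b).eval x <;> simp only [flat] <;> split_ifs <;> simp_all
  case inter_right =>
    intro h a b
    rw [key]
    intro x
    simp only [domRestrict, e₁]
    cases (θ a).eval x <;> cases (θ b).eval x <;> simp only [flat] <;> split_ifs <;> simp_all
  case inter_agree =>
    intro h a b c h₁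
    rw [key] at h₁ ⊢
    intro x
    replace h₁ := h₁ x
    revert h₁
    simp only [domRestrict, e₁]
    cases (θ a).eval x <;> cases (θ b).eval x <;> cases (θ c).eval x <;>
      simp only [flat] <;> split_ifs <;> simp_all
  case update_on =>
    intro h a b
    rw [key]
    intro x
    simp only [domRestrict, e₁]
    cases (θ a).eval x <;> cases (θ b).eval x <;> simp [flat]
  case update_off =>
    intro h a b
    rw [key]
    intro x
    simp only [e₁]
    cases (θ a).eval x <;> cases (θ b).eval x <;> simp [flat]
  case union_on =>
    intro h a b
    rw [key]
    intro x
    simp only [domRestrict, e₁]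
    cases (θ a).eval x <;> cases (θ b).eval x <;> simp [flat]
  case union_off =>
    intro h a b
    rw [key]
    intro x
    simp only [e₁]
    cases (θ a).eval x <;> cases (θ b).eval x <;> simp [flat]

/-- A map into a flat algebra that preserves antidomain restriction is a point as soon as the
intersection of two elements with equal values is defined. -/
lemma Axioms.isPoint (ax : Axioms hσ A) {h : A → Option X}
    (h₁ : ∀ a b, h (op hσ a b) = flat .antiRestrict (h a) (h b))
    (h₂ : ∀ (hi : Op.inter ∈ σ) (a b : A), h a = h b → h a ≠ none → h (op hi a b) ≠ none) :
    IsPoint σ h := by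
  have on : ∀ {a : A}, h a ≠ none → ∀ b, h (domRestrict hσ a b) = h b := by
    intro a ha b
    obtain ⟨x, hx⟩ := Option.ne_none_iff_exists'.mp ha
    rw [domRestrict, h₁, h₁, hx]
    rfl
  have off : ∀ {a : A}, h a = none → ∀ b, h (op hσ a b) = h b := by
    intro a ha b
    rw [h₁, ha]
    rfl
  intro o ho a b
  cases o
  · exact h₁ a b
  · have le : ∀ {c : A}, domRestrict hσ (op ho a b) c = op ho a b →
        h (op ho a b) ≠ none → h (op ho a b) = h c := fun e hc => by
      conv_lhs => rw [← e]
      exact on hc _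
    have hl := le (ax.inter_left ho a b)
    have hr := le (ax.inter_right ho a b)
    simp only [flat]
    -- When the intersection is defined, it lies below both elements and so shares both values. When
    -- it is undefined, `h₂` excludes equal defined values.
    by_cases hc : h (op ho a b) = none
    · rw [hc]
      split_ifs with e
      · by_contra hn
        exact h₂ ho a b e (fun h => hn h.symm) hc
      · rfl
    · rw [if_pos ((hl hc).symm.trans (hr hc)), hl hc]
  · rcases hb : h b with _ | y
    · have := congrArg h (ax.update_off ho a b)
      rw [off hb, off hb] at this
      rw [this]
      cases h a <;> rfl
    · have hb' : h b ≠ none := by simp [hb]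
      have := congrArg h (ax.update_on ho a b)
      rw [on hb', domRestrict, h₁, h₁, hb] at this
      rw [this]
      cases h a <;> rfl
  · rcases ha : h a with _ | y
    · have := congrArg h (ax.union_off ho a b)
      rw [off ha, off ha] at this
      rw [this]
      rfl
    · have ha' : h a ≠ none := by simp [ha]
      have := congrArg h (ax.union_on ho a b)
      rw [on ha', ha] at this
      rw [this]
      rfl

end

/-! ### Prime ideals and the representation theorem -/

section Prime

variable {σ : Set Op} {hσ : Op.antiRestrict ∈ σ} {A : Type u} [(lang σ).Structure A]

/-- Ideals: sets containing zero and closed under detachment for antidomain restriction. -/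
def IsIdealSet (hσ : Op.antiRestrict ∈ σ) (J : Set A) : Prop :=
  (∀ a : A, op hσ a a ∈ J) ∧ ∀ a b : A, a ∈ J → op hσ a b ∈ J → b ∈ J

/-- Prime ideals. -/
def IsPrimeSet (hσ : Op.antiRestrict ∈ σ) (J : Set A) : Prop :=
  ∀ a b : A, op hσ a b ∈ J ↔ (a ∈ J → b ∈ J)

lemma IsPrimeSet.domRestrict_mem {J : Set A} (hJ : IsPrimeSet hσ J) (a b : A) :
    domRestrict hσ a b ∈ J ↔ a ∈ J ∨ b ∈ J := by
  rw [domRestrict, hJ, hJ]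
  tauto

/-- This is Lindenbaum's lemma for implicational logic: an ideal maximal among those omitting `a` is
prime, by the deduction theorem and Peirce's law. -/
theorem Axioms.exists_prime (ax : Axioms hσ A) {I : Set A} (hI : IsIdealSet hσ I) {a : A}
    (ha : a ∉ I) : ∃ J, I ⊆ J ∧ IsPrimeSet hσ J ∧ a ∉ J := by
  obtain ⟨J, hIJ, ⟨hJ, haJ⟩, hmax⟩ := zorn_subset_nonempty {J | IsIdealSet hσ J ∧ a ∉ J} (by
    intro c hc hchain ⟨K, hK⟩
    refine ⟨⋃₀ c, ⟨⟨fun b => ⟨K, hK, (hc hK).1.1 b⟩, ?_⟩, ?_⟩,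
      fun s hs => Set.subset_sUnion_of_mem hs⟩
    · rintro b d ⟨S, hS, hb⟩ ⟨T, hT, hd⟩
      rcases hchain.total hS hT with h | h
      · exact ⟨T, hT, (hc hT).1.2 b d (h hb) hd⟩
      · exact ⟨S, hS, (hc hS).1.2 b d hb (h hd)⟩
    · rintro ⟨S, hS, h⟩
      exact (hc hS).2 h) I ⟨hI, ha⟩
  refine ⟨J, hIJ, ?_, haJ⟩
  have weaken : ∀ {b : A} (c : A), b ∈ J → op hσ c b ∈ J := fun {b} c hb =>
    hJ.2 b _ hb (ax.weaken b c ▸ hJ.1 b)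
  have adjoin : ∀ c, c ∉ J → op hσ c a ∈ J := by
    intro c hc
    by_contra hca
    -- The ideal generated by `J` and `c`, as in the deduction theorem. If it omitted `a`,
    -- maximality would put `c` in `J`.
    have hK : IsIdealSet hσ {b | op hσ c b ∈ J} := by
      refine ⟨fun b => ?_, fun b d hb hd => ?_⟩
      · change op hσ c (op hσ b b) ∈ J
        rw [ax.anti_zero]
        exact hJ.1 b
      · exact hJ.2 _ _ hb ((ax.distrib c b d).symm ▸ hd)
    exact hc (hmax ⟨hK, hca⟩ (fun b hb => weaken c hb) (hJ.1 c))
  intro b c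
  refine ⟨fun h hb => hJ.2 b c hb h, fun h => ?_⟩
  by_cases hb : b ∈ J
  · exact weaken b (h hb)
  · by_contra hbc
    -- Both `b` and `b ▷ c` imply `a` modulo `J`, so the axiom `peirce` forces `a` into `J`.
    refine haJ (hJ.2 _ _ (adjoin _ hbc) (hJ.2 _ _ (adjoin b hb) ?_))
    exact (ax.peirce b a c).symm ▸ hJ.1 a

open Classical in
/-- The value of an element at a prime ideal: the set of elements that agree with it somewhere
outside the ideal. -/
noncomputable def primePoint (hσ : Op.antiRestrict ∈ σ) (J : Set A) (a : A) : Option (Set A) :=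
  if IsPrimeSet hσ J ∧ a ∉ J then
    some {b | ∃ c ∉ J, domRestrict hσ c a = domRestrict hσ c b}
  else none

lemma primePoint_eq_none {J : Set A} (hJ : IsPrimeSet hσ J) {a : A} :
    primePoint hσ J a = none ↔ a ∈ J := by
  simp [primePoint, hJ]

/-- Values are germs: agreement on the domain of an element outside `J` is an equivalence relation,
because primeness keeps the common part of two such domains outside `J`. -/
lemma Axioms.primePoint_eq (ax : Axioms hσ A) {J : Set A} (hJ : IsPrimeSet hσ J) {a b : A}
    (ha : a ∉ J) (hb : b ∉ J) :
    primePoint hσ J a = primePoint hσ J b ↔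
      ∃ c ∉ J, domRestrict hσ c a = domRestrict hσ c b := by
  have trans : ∀ {a b d : A}, (∃ c ∉ J, domRestrict hσ c a = domRestrict hσ c b) →
      (∃ c ∉ J, domRestrict hσ c b = domRestrict hσ c d) →
      ∃ c ∉ J, domRestrict hσ c a = domRestrict hσ c d := by
    rintro a b d ⟨c, hc, e⟩ ⟨c', hc', e'⟩
    refine ⟨domRestrict hσ c c', by rw [hJ.domRestrict_mem]; tauto, ?_⟩
    rw [ax.assoc, ax.comm, e, ax.comm, e', ← ax.assoc]
  simp only [primePoint, hJ, ha, hb, not_false_eq_true, and_self, if_true, Option.some_inj]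
  constructor
  · intro h
    have : b ∈ {d | ∃ c ∉ J, domRestrict hσ c b = domRestrict hσ c d} := ⟨b, hb, rfl⟩
    rwa [← h] at this
  · intro h
    have h' : ∃ c ∉ J, domRestrict hσ c b = domRestrict hσ c a :=
      h.imp fun c hc => ⟨hc.1, hc.2.symm⟩
    exact Set.ext fun d => ⟨trans h', trans h⟩

lemma Axioms.isPoint_primePoint (ax : Axioms hσ A) (J : Set A) :
    IsPoint σ (primePoint hσ J) := by
  by_cases hJ : IsPrimeSet hσ J
  swap
  · intro o ho a b
    simp [primePoint, hJ]
  refine ax.isPoint (fun a b => ?_) fun hi a b hab ha => ?_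
  · by_cases ha : a ∈ J
    · rw [(primePoint_eq_none hJ).mpr ha]
      by_cases hb : b ∈ J
      · have hab : op hσ a b ∈ J := (hJ a b).mpr fun _ => hb
        rw [(primePoint_eq_none hJ).mpr hb, (primePoint_eq_none hJ).mpr hab]
        rfl
      · have hab : op hσ a b ∉ J := fun h => hb ((hJ a b).mp h ha)
        refine (ax.primePoint_eq hJ hab hb).mpr ⟨op hσ a b, hab, ?_⟩
        rw [ax.idem, ax.anti_le]
    · obtain ⟨x, hx⟩ := Option.ne_none_iff_exists'.mp (mt (primePoint_eq_none hJ).mp ha)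
      rw [hx, (primePoint_eq_none hJ).mpr ((hJ a b).mpr fun h => absurd h ha)]
      rfl
  · have hb : b ∉ J := fun h => ha (hab.trans ((primePoint_eq_none hJ).mpr h))
    replace ha : a ∉ J := mt (primePoint_eq_none hJ).mpr ha
    obtain ⟨c, hc, e⟩ := (ax.primePoint_eq hJ ha hb).mp hab
    rw [Ne, primePoint_eq_none hJ]
    -- On the domain of `c` the intersection coincides with `a`, so it cannot lie in `J` when `c`
    -- and `a` do not.
    intro h
    have := (hJ.domRestrict_mem c (op hi a b)).mpr (.inr h)
    rw [ax.inter_agree hi a b c e, hJ.domRestrict_mem] at this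
    tauto

theorem Axioms.representable (ax : Axioms hσ A) : Representable σ A := by
  have sep : ∀ a b : A, (∀ J, primePoint hσ J a = primePoint hσ J b) →
      domRestrict hσ a b = a := by
    intro a b h
    by_contra hab
    have zero_dr : ∀ b c : A, domRestrict hσ (op hσ b b) c = op hσ b b := fun b c => by
      rw [ax.zero b c]
      exact congrArg (op hσ · c) (ax.idem c)
    -- The elements on whose domain `a` and `b` agree form an ideal, by the axiom `locality`. A
    -- prime ideal containing it gives `a` and `b` different germs.
    obtain ⟨J, hIJ, hJ, ha⟩ := ax.exists_prime
      (I := {c | domRestrict hσ c a = domRestrict hσ c b}) (a := a)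
      ⟨fun c => (zero_dr c a).trans (zero_dr c b).symm, fun c d hc hd =>
        ax.locality c d a b hc hd⟩ (fun h => hab (by
          change domRestrict hσ a a = domRestrict hσ a b at h
          rw [← h, ax.idem]))
    have hb : b ∉ J := by
      rw [← primePoint_eq_none hJ, ← h J, primePoint_eq_none hJ]
      exact ha
    obtain ⟨c, hc, e⟩ := (ax.primePoint_eq hJ ha hb).mp (h J)
    exact hc (hIJ e)
  exact ⟨Set A, ⟨Representation.ofPoints _ ax.isPoint_primePoint fun a b h =>
    ax.antisymm a b (sep a b h) (sep b a fun J => (h J).symm)⟩⟩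

theorem axioms_iff_representable (hσ : Op.antiRestrict ∈ σ) :
    Axioms hσ A ↔ Representable σ A :=
  ⟨Axioms.representable, fun ⟨_, ⟨θ⟩⟩ => θ.axioms hσ⟩

end Prime

/-! ### Atoms and complete representations -/

section Atoms

variable {σ : Set Op} {hσ : Op.antiRestrict ∈ σ} {A : Type u} [(lang σ).Structure A] {X : Type u}

namespace Representation

variable (θ : Representation σ A X)

lemma eval_anti (a b : A) (x : X) : (θ (op hσ a b)).eval x =
    flat .antiRestrict ((θ a).eval x) ((θ b).eval x) :=
  θ.isPoint x _ hσ a b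

lemma eval_anti_eq_some {a b : A} {x y : X} : (θ (op hσ a b)).eval x = some y ↔
    (θ a).eval x = none ∧ (θ b).eval x = some y := by
  rw [eval_anti]
  cases (θ a).eval x <;> simp [flat]

lemma eval_dr_eq_some {a b : A} {x y : X} : (θ (domRestrict hσ a b)).eval x = some y ↔
    (θ a).eval x ≠ none ∧ (θ b).eval x = some y := by
  rw [domRestrict, eval_anti, eval_anti]
  cases (θ a).eval x <;> cases (θ b).eval x <;> simp [flat]

lemma eq_iff {a b : A} : a = b ↔ ∀ x y, (θ a).eval x = some y ↔ (θ b).eval x = some y :=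
  ⟨fun e x y => by rw [e], fun h => θ.eq_of_eval fun x => Option.ext (h x)⟩

lemma dr_eq_iff {a b : A} : domRestrict hσ a b = a ↔
    ∀ x y, (θ a).eval x = some y → (θ b).eval x = some y := by
  rw [θ.eq_iff]
  simp only [eval_dr_eq_some]
  refine ⟨fun h x y e => ((h x y).mpr e).2, fun h x y => ⟨fun ⟨h₁, h₂⟩ => ?_, fun e => ⟨?_, h x y e⟩⟩⟩
  · obtain ⟨z, hz⟩ := Option.ne_none_iff_exists'.mp h₁
    rw [hz, ← h₂, h x z hz]
  · simp [e]

lemma eq_zero_iff {a : A} : a = op hσ a a ↔ ∀ x y, (θ a).eval x ≠ some y := by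
  rw [θ.eq_iff]
  simp only [eval_anti_eq_some]
  refine forall₂_congr fun x y => ?_
  cases (θ a).eval x <;> simp

lemma ne_zero_of_eval {a : A} {x y : X} (h : (θ a).eval x = some y) : a ≠ op hσ a a :=
  fun e => θ.eq_zero_iff.mp e x y h

/-- The domain of an atom is contained in, or disjoint from, the domain of any element. -/
lemma atom_dichotomy {c : A} (hc : IsAtomElt hσ c) (a : A) :
    (∀ x y, (θ c).eval x = some y → (θ a).eval x ≠ none) ∨
      (∀ x y, (θ c).eval x = some y → (θ a).eval x = none) := by
  -- The part of `c` off the domain of `a` lies below the atom `c`, so it is zero or all of `c`.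
  by_cases h : op hσ a c = op hσ (op hσ a c) (op hσ a c)
  · left
    intro x y hx ha
    exact θ.eq_zero_iff.mp h x y (θ.eval_anti_eq_some.mpr ⟨ha, hx⟩)
  · right
    have := hc.2 _ (θ.dr_eq_iff.mpr fun x y h => (θ.eval_anti_eq_some.mp h).2) h
    intro x y hx
    rw [← this, eval_anti_eq_some] at hx
    exact hx.1

lemma atom_eval {c : A} (hc : IsAtomElt hσ c) : ∃ x y, (θ c).eval x = some y := by
  by_contra! h
  exact hc.1 (θ.eq_zero_iff.mpr h)

lemma le_inter_iff (θ : Representation σ A X) (hi : Op.inter ∈ σ) (a b : A) :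
    letI := algLE hσ A
    ∀ c : A, c ≤ op hi a b ↔ c ≤ a ∧ c ≤ b := by
  intro c
  have ax := θ.axioms hσ
  constructor
  · intro h
    have h₁ := θ.dr_eq_iff.mp h
    have h₂ := θ.dr_eq_iff.mp (ax.inter_left hi a b)
    have h₃ := θ.dr_eq_iff.mp (ax.inter_right hi a b)
    exact ⟨θ.dr_eq_iff.mpr fun x y e => h₂ x y (h₁ x y e),
      θ.dr_eq_iff.mpr fun x y e => h₃ x y (h₁ x y e)⟩
  · rintro ⟨h₁, h₂⟩
    exact (ax.inter_agree hi a b c (Eq.trans h₁ (Eq.symm h₂))).trans h₁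

/-! ### From complete representations to separating atoms -/

/-- A representation is meet complete only if the atoms are separating. -/
theorem atomsSeparating_of_isMeetComplete (hθ : IsMeetComplete hσ θ) :
    AtomsSeparating hσ A := by
  let := algLE hσ A
  intro a b hab
  have hab' : ¬ domRestrict hσ a b = a := hab
  rw [θ.dr_eq_iff] at hab'
  push Not at hab'
  obtain ⟨x, y, ha, hb⟩ := hab'
  let S : Set A := {c | domRestrict hσ c a = c ∧ (θ c).eval x = some y}
  have haS : a ∈ S := ⟨θ.dr_eq_iff.mpr fun _ _ => id, ha⟩
  have compl : ∀ m : A, domRestrict hσ m a = m → (θ m).eval x = none → op hσ m a ∈ S :=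
    fun m _ h => ⟨θ.dr_eq_iff.mpr fun _ _ h => (θ.eval_anti_eq_some.mp h).2,
      θ.eval_anti_eq_some.mpr ⟨h, ha⟩⟩
  -- Otherwise zero is the meet of `S`, although `(x, y)` belongs to the intersection of the images.
  obtain ⟨m, hm, hm₀⟩ : ∃ m ∈ lowerBounds S, m ≠ op hσ m m := by
    by_contra! h
    have hglb : IsGLB S (op hσ a a) := by
      refine ⟨fun s _ => θ.dr_eq_iff.mpr fun x y h => ?_, fun m hm => θ.dr_eq_iff.mpr fun x y e => ?_⟩
      · rw [θ.eval_anti_eq_some] at h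
        simp [h.1] at h
      · exact absurd e (θ.eq_zero_iff.mp (h m hm) x y)
    have := hθ S _ ⟨a, haS⟩ hglb
    have hmem : (x, y) ∈ ⋂ s ∈ S, (θ s).graph :=
      Set.mem_iInter₂.mpr fun s hs => PartialFunction.eval_eq_some.mp hs.2
    rw [← this, ← PartialFunction.eval_eq_some, θ.eval_anti_eq_some] at hmem
    simp [hmem.1] at hmem
  have hma : domRestrict hσ m a = m := hm haS
  have disj : ∀ c : A, domRestrict hσ c m = c → op hσ c a ∈ S → c = op hσ c c := by
    intro c hcm hc
    refine θ.eq_zero_iff.mpr fun z w hz => ?_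
    have h₁ := θ.dr_eq_iff.mp hcm z w hz
    have h₂ := θ.dr_eq_iff.mp (hm hc) z w h₁
    rw [θ.eval_anti_eq_some] at h₂
    simp [h₂.1] at hz
  -- If `c` missed `x`, then `c ▷ a` would be in `S`, so `c ≤ m ≤ c ▷ a` and `c` would be disjoint
  -- from itself. Hence nonzero elements below `m` are in `S`, and therefore above `m`.
  have mem : ∀ c : A, domRestrict hσ c m = c → c ≠ op hσ c c → (θ c).eval x = some y := by
    intro c hcm hc₀
    have hca : domRestrict hσ c a = c := θ.dr_eq_iff.mpr fun z w h =>
      θ.dr_eq_iff.mp hma z w (θ.dr_eq_iff.mp hcm z w h)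
    by_contra h
    refine hc₀ (disj c hcm (compl c hca ?_))
    by_contra h'
    obtain ⟨w, hw⟩ := Option.ne_none_iff_exists'.mp h'
    have := θ.dr_eq_iff.mp hca x w hw
    rw [ha] at this
    exact h (hw.trans this.symm)
  have hmx := mem m (θ.dr_eq_iff.mpr fun _ _ => id) hm₀
  refine ⟨m, ⟨hm₀, fun c hc hc₀ => ?_⟩, hma, fun h => hb (θ.dr_eq_iff.mp h x y hmx)⟩
  have hca : domRestrict hσ c a = c := θ.dr_eq_iff.mpr fun z w h =>
    θ.dr_eq_iff.mp hma z w (θ.dr_eq_iff.mp hc z w h)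
  exact (θ.axioms hσ).antisymm c m hc (hm ⟨hca, mem c hc hc₀⟩)

/-- In the presence of intersection, a representation is join complete only if the atoms are
separating. -/
theorem atomsSeparating_of_isJoinComplete (hi : Op.inter ∈ σ) (hθ : IsJoinComplete hσ θ) :
    AtomsSeparating hσ A := by
  let := algLE hσ A
  have ax := θ.axioms hσ
  have le_trans : ∀ {a b c : A}, a ≤ b → b ≤ c → a ≤ c := fun {a b c} h₁ h₂ =>
    θ.dr_eq_iff.mpr fun z w h => θ.dr_eq_iff.mp h₂ z w (θ.dr_eq_iff.mp h₁ z w h)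
  have le_refl : ∀ a : A, a ≤ a := ax.idem
  have anti_le : ∀ a b : A, op hσ a b ≤ b := ax.anti_le
  have disj : ∀ {a b c : A}, c ≤ a → c ≤ op hσ a b → c = op hσ c c := by
    intro a b c h₁ h₂
    refine θ.eq_zero_iff.mpr fun z w hz => ?_
    have e₁ := θ.dr_eq_iff.mp h₁ z w hz
    have e₂ := θ.dr_eq_iff.mp h₂ z w hz
    rw [θ.eval_anti_eq_some, e₁] at e₂
    simp at e₂
  intro a₀ b hab
  have hab' : ¬ domRestrict hσ a₀ b = a₀ := hab
  rw [θ.dr_eq_iff] at hab'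
  push Not at hab'
  obtain ⟨x, y, ha₀, hb⟩ := hab'
  -- The part of `a₀` where it does not agree with `b`; nothing nonzero below it is below `b`.
  set a : A := op hσ (op hi a₀ b) a₀ with ha_def
  have ha : (θ a).eval x = some y := by
    refine θ.eval_anti_eq_some.mpr ⟨?_, ha₀⟩
    by_contra h
    obtain ⟨w, hw⟩ := Option.ne_none_iff_exists'.mp h
    have h₁ := θ.dr_eq_iff.mp (ax.inter_left hi a₀ b) x w hw
    have h₂ := θ.dr_eq_iff.mp (ax.inter_right hi a₀ b) x w hw
    exact hb (h₂.trans (h₁.symm.trans ha₀))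
  suffices h : ∃ d : A, IsAtomElt hσ d ∧ d ≤ a by
    obtain ⟨d, hd, hda⟩ := h
    have hda₀ := le_trans hda (anti_le _ _)
    exact ⟨d, hd, hda₀, fun hdb => hd.1 (disj ((θ.le_inter_iff hi a₀ b d).mpr ⟨hda₀, hdb⟩) hda)⟩
  let S : Set A := {c | c ≤ a ∧ (θ c).eval x = none}
  have mem_of_le : ∀ c : A, c ≤ a → (θ c).eval x ≠ none → (θ c).eval x = some y := by
    intro c hc h
    obtain ⟨w, hw⟩ := Option.ne_none_iff_exists'.mp h
    exact hw.trans ((θ.dr_eq_iff.mp hc x w hw).symm.trans ha)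
  have anti_none : ∀ {c d : A}, (θ c).eval x ≠ none → (θ (op hσ c d)).eval x = none := by
    intro c d h
    rw [θ.eval_anti]
    obtain ⟨w, hw⟩ := Option.ne_none_iff_exists'.mp h
    rw [hw]
    rfl
  -- Otherwise `a` is the join of `S`, although no member of `S` is defined at `x`. The atom will be
  -- the part of `a` off the domain of `u ∧ a`.
  obtain ⟨u, hu, hua⟩ : ∃ u ∈ upperBounds S, ¬ a ≤ u := by
    by_contra! h
    have hlub : IsLUB S a := ⟨fun s hs => hs.1, fun u hu => h u hu⟩
    have hmem : (x, y) ∈ (θ a).graph := PartialFunction.eval_eq_some.mp ha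
    rw [hθ S a hlub, Set.mem_iUnion₂] at hmem
    obtain ⟨s, hs, h⟩ := hmem
    rw [← PartialFunction.eval_eq_some, hs.2] at h
    simp at h
  have hv : ∀ s ∈ S, s ≤ op hi u a := fun s hs => (θ.le_inter_iff hi u a s).mpr ⟨hu hs, hs.1⟩
  have hva : op hi u a ≤ a := ax.inter_right hi u a
  have hd₀ : op hσ (op hi u a) a ∉ S := by
    intro hS
    have h₀ := disj (hv _ hS) (le_refl _)
    refine hua (le_trans (θ.dr_eq_iff.mpr fun z w hz => ?_) (ax.inter_left hi u a))
    have h₁ := θ.eq_zero_iff.mp h₀ z w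
    rw [Ne, θ.eval_anti_eq_some, not_and] at h₁
    obtain ⟨w', hw'⟩ := Option.ne_none_iff_exists'.mp fun h => h₁ h hz
    rw [hw', ← hz, θ.dr_eq_iff.mp hva z w' hw']
  have hdx : (θ (op hσ (op hi u a) a)).eval x ≠ none := fun h => hd₀ ⟨anti_le _ _, h⟩
  obtain ⟨w, hw⟩ := Option.ne_none_iff_exists'.mp hdx
  refine ⟨_, ⟨θ.ne_zero_of_eval hw, fun c hc hc₀ => ?_⟩, anti_le _ _⟩
  have hca := le_trans hc (anti_le _ _)
  have hcx : (θ c).eval x ≠ none := fun h => hc₀ (disj (hv c ⟨hca, h⟩) hc)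
  -- The remainder of the candidate off the domain of `c` avoids `x`, so it lies below `u ∧ a` as
  -- well as in its complement, and vanishes.
  have hrest : op hσ c (op hσ (op hi u a) a) ∈ S :=
    ⟨le_trans (anti_le _ _) (anti_le _ _), anti_none hcx⟩
  have h₀ := disj (hv _ hrest) (anti_le _ _)
  refine ax.antisymm _ _ hc (θ.dr_eq_iff.mpr fun z w hz => ?_)
  have h₁ := θ.eq_zero_iff.mp h₀ z w
  rw [Ne, θ.eval_anti_eq_some, not_and] at h₁
  obtain ⟨w', hw'⟩ := Option.ne_none_iff_exists'.mp fun h => h₁ h hz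
  rw [hw', ← hz, θ.dr_eq_iff.mp hc z w' hw']

end Representation

/-! ### The representation on the atoms -/

open Classical in
/-- The value of an element at an atom: its restriction to the domain of the atom, if nonzero. -/
noncomputable def atomPoint (hσ : Op.antiRestrict ∈ σ) (c a : A) : Option A :=
  if IsAtomElt hσ c ∧ domRestrict hσ a c = c then some (domRestrict hσ c a) else none

lemma atomPoint_eq_some {a c d : A} : atomPoint hσ c a = some d ↔
    IsAtomElt hσ c ∧ domRestrict hσ a c = c ∧ domRestrict hσ c a = d := by
  simp [atomPoint, and_assoc]

namespace Representation

variable (θ : Representation σ A X)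

lemma atomPoint_ne_none {a c : A} (hc : IsAtomElt hσ c) : atomPoint hσ c a ≠ none ↔
    ∀ x y, (θ c).eval x = some y → (θ a).eval x ≠ none := by
  simp only [atomPoint, hc, true_and, ne_eq, ite_eq_right_iff, reduceCtorEq, imp_false, not_not,
    θ.eq_iff, θ.eval_dr_eq_some]
  exact forall₂_congr fun x y => by tauto

/-- By `atom_dichotomy`, a domain that does not contain that of `c` is disjoint from it. -/
lemma atomPoint_eq_none {a c : A} (hc : IsAtomElt hσ c) : atomPoint hσ c a = none ↔
    ∀ x y, (θ c).eval x = some y → (θ a).eval x = none := by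
  constructor
  · intro h
    exact (θ.atom_dichotomy hc a).resolve_left fun h' => (θ.atomPoint_ne_none hc).mpr h' h
  · intro h
    by_contra h'
    obtain ⟨x, y, hx⟩ := θ.atom_eval hc
    exact (θ.atomPoint_ne_none hc).mp h' x y hx (h x y hx)

lemma isPoint_atomPoint (θ : Representation σ A X) (c : A) : IsPoint σ (atomPoint hσ c) := by
  by_cases hc : IsAtomElt hσ c
  swap
  · intro o ho a b
    simp [atomPoint, hc]
  refine (θ.axioms hσ).isPoint (hσ := hσ) (fun a b => ?_) fun hi a b hab ha => ?_
  · rcases ha : atomPoint hσ c a with _ | d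
    · have ha' := (θ.atomPoint_eq_none hc).mp ha
      have e : domRestrict hσ c (op hσ a b) = domRestrict hσ c b := by
        simp only [θ.eq_iff, θ.eval_dr_eq_some, θ.eval_anti_eq_some]
        refine fun x y => ⟨fun h => ⟨h.1, h.2.2⟩, fun h => ⟨h.1, ?_, h.2⟩⟩
        obtain ⟨z, hz⟩ := Option.ne_none_iff_exists'.mp h.1
        exact ha' x z hz
      have e' : domRestrict hσ (op hσ a b) c = domRestrict hσ b c := by
        simp only [θ.eq_iff, θ.eval_dr_eq_some]
        refine fun x y => and_congr_left fun h => ?_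
        rw [θ.eval_anti, ha' x y h]
        rfl
      ext d
      simp only [flat, atomPoint_eq_some, e, e']
    · have ha' := (θ.atomPoint_ne_none (a := a) hc).mp (by simp [ha])
      refine (θ.atomPoint_eq_none hc).mpr fun x y hx => ?_
      obtain ⟨z, hz⟩ := Option.ne_none_iff_exists'.mp (ha' x y hx)
      rw [θ.eval_anti, hz]
      rfl
  · obtain ⟨d, hd⟩ := Option.ne_none_iff_exists'.mp ha
    have hda := atomPoint_eq_some.mp hd
    have hdb := atomPoint_eq_some.mp (hab ▸ hd)
    have e := (θ.axioms hσ).inter_agree hi a b c (hda.2.2.trans hdb.2.2.symm)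
    refine (θ.atomPoint_ne_none hc).mpr fun x y hx hn => ?_
    obtain ⟨z, hz⟩ := Option.ne_none_iff_exists'.mp ((θ.atomPoint_ne_none hc).mp ha x y hx)
    have : (θ (domRestrict hσ c a)).eval x = some z :=
      θ.eval_dr_eq_some.mpr ⟨by simp [hx], hz⟩
    rw [← e, θ.eval_dr_eq_some, hn] at this
    simp at this

/-- The representation on the set of atoms of a representable algebra in which the atoms are
separating. -/
noncomputable def atomic (hs : AtomsSeparating hσ A) : Representation σ A A :=
  .ofPoints (atomPoint hσ) θ.isPoint_atomPoint fun a b h => by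
    have le : ∀ {a b : A}, (∀ c, atomPoint hσ c a = atomPoint hσ c b) →
        domRestrict hσ a b = a := by
      intro a b h
      by_contra hab
      obtain ⟨c, hc, hca, hcb⟩ := hs a b hab
      -- An atom `c` below `a` is itself the value of `a` at `c`; were it also the value of `b`, it
      -- would be below `b`.
      have hca' : domRestrict hσ c a = c := hca
      have : atomPoint hσ c a = some c := by
        refine atomPoint_eq_some.mpr ⟨hc, ?_, hca⟩
        simp only [θ.eq_iff, θ.eval_dr_eq_some]
        refine fun x y => ⟨fun h => h.2, fun h => ⟨?_, h⟩⟩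
        simp [θ.dr_eq_iff.mp hca' x y h]
      rw [h, atomPoint_eq_some] at this
      exact hcb this.2.2
    exact (θ.axioms hσ).antisymm a b (le h) (le fun c => (h c).symm)

lemma mem_atomic {hs : AtomsSeparating hσ A} {a : A} {c d : A} :
    (c, d) ∈ (θ.atomic hs a).graph ↔ atomPoint hσ c a = some d :=
  Iff.rfl

lemma atomPoint_of_le (θ : Representation σ A X) {a b c d : A} (hab : domRestrict hσ a b = a)
    (h : atomPoint hσ c a = some d) : atomPoint hσ c b = some d := by
  have hc := (atomPoint_eq_some.mp h).1
  have := θ.isPoint_atomPoint (hσ := hσ) c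
  have e := this.domRestrict (hσ := hσ) a b
  rw [hab, h] at e
  rw [e]
  cases atomPoint hσ c b <;> rfl

lemma atomPoint_le (θ : Representation σ A X) {a c d : A} (h : atomPoint hσ c a = some d) : domRestrict hσ d a = d := by
  rw [← (atomPoint_eq_some.mp h).2.2]
  exact θ.dr_eq_iff.mpr fun x y h => (θ.eval_dr_eq_some.mp h).2

/-- Values are themselves elements of the algebra: `d` is the restriction of `a` to the domain of
`c`, and so is its own value at `c`. This is what lets a common value act as a lower bound. -/
lemma atomPoint_self (θ : Representation σ A X) {a c d : A} (h : atomPoint hσ c a = some d) :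
    atomPoint hσ c d = some d := by
  have hc := (atomPoint_eq_some.mp h).1
  have e := (θ.isPoint_atomPoint (hσ := hσ) c).domRestrict (hσ := hσ) d a
  rw [θ.atomPoint_le h, h] at e
  rcases hd : atomPoint hσ c d with _ | d'
  · have h₁ := (θ.atomPoint_eq_none hc).mp hd
    obtain ⟨x, y, hx⟩ := θ.atom_eval hc
    obtain ⟨z, hz⟩ := Option.ne_none_iff_exists'.mp
      ((θ.atomPoint_ne_none (a := a) hc).mp (by simp [h]) x y hx)
    have h₂ := h₁ x y hx
    rw [← (atomPoint_eq_some.mp h).2.2] at h₂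
    have := (θ.eval_dr_eq_some (hσ := hσ) (a := c) (b := a)).mpr ⟨by simp [hx], hz⟩
    simp [h₂] at this
  · rw [← hd, e, hd]
    rfl

theorem isMeetComplete_atomic (hs : AtomsSeparating hσ A) :
    IsMeetComplete hσ (θ.atomic hs) := by
  intro S m ⟨s₀, hs₀⟩ hm
  ext ⟨c, d⟩
  simp only [Set.mem_iInter, θ.mem_atomic]
  refine ⟨fun h s hs => θ.atomPoint_of_le (hm.1 hs) h, fun h => ?_⟩
  -- The common value `d` is a lower bound of `S`, hence below `m`, and `m` inherits its value at
  -- `c`.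
  exact θ.atomPoint_of_le (hm.2 fun s hs => θ.atomPoint_le (h s hs)) (θ.atomPoint_self (h s₀ hs₀))

theorem isJoinComplete_atomic (hs : AtomsSeparating hσ A) :
    IsJoinComplete hσ (θ.atomic hs) := by
  intro S j hj
  ext ⟨c, d⟩
  simp only [Set.mem_iUnion, θ.mem_atomic, exists_prop]
  refine ⟨fun h => ?_, fun ⟨s, hs, h⟩ => θ.atomPoint_of_le (hj.1 hs) h⟩
  have hc := (atomPoint_eq_some.mp h).1
  have hp := θ.isPoint_atomPoint (hσ := hσ) c
  by_contra! hn
  have hnone : ∀ s ∈ S, atomPoint hσ c s = none := by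
    intro s hs
    by_contra h'
    obtain ⟨d', hd'⟩ := Option.ne_none_iff_exists'.mp h'
    have := θ.atomPoint_of_le (hj.1 hs) hd'
    rw [h] at this
    exact hn s hs (hd'.trans this.symm)
  -- If every member of `S` misses the domain of `c`, then `c ▷ j` is an upper bound of `S` smaller
  -- than `j`.
  have hle : domRestrict hσ j (op hσ c j) = j := hj.2 fun s hs => by
    refine θ.dr_eq_iff.mpr fun x y hx => θ.eval_anti_eq_some.mpr
      ⟨?_, θ.dr_eq_iff.mp (hj.1 hs) x y hx⟩
    by_contra h'
    obtain ⟨z, hz⟩ := Option.ne_none_iff_exists'.mp h'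
    have := (θ.atomPoint_eq_none hc).mp (hnone s hs) x z hz
    simp [hx] at this
  obtain ⟨x, y, hx⟩ := θ.atom_eval hc
  obtain ⟨z, hz⟩ := Option.ne_none_iff_exists'.mp
    ((θ.atomPoint_ne_none (a := j) hc).mp (by simp [h]) x y hx)
  have := (θ.eval_anti_eq_some.mp (θ.dr_eq_iff.mp hle x z hz)).1
  simp [hx] at this

end Representation

theorem meetCompletelyRepresentable_iff (hσ : Op.antiRestrict ∈ σ) :
    MeetCompletelyRepresentable hσ A ↔ Representable σ A ∧ AtomsSeparating hσ A :=
  ⟨fun ⟨X, θ, h⟩ => ⟨⟨X, ⟨θ⟩⟩, θ.atomsSeparating_of_isMeetComplete h⟩,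
    fun ⟨⟨_, ⟨θ⟩⟩, hs⟩ => ⟨A, θ.atomic hs, θ.isMeetComplete_atomic hs⟩⟩

theorem joinCompletelyRepresentable_iff (hσ : Op.antiRestrict ∈ σ) (hi : Op.inter ∈ σ) :
    JoinCompletelyRepresentable hσ A ↔ Representable σ A ∧ AtomsSeparating hσ A :=
  ⟨fun ⟨X, θ, h⟩ => ⟨⟨X, ⟨θ⟩⟩, θ.atomsSeparating_of_isJoinComplete hi h⟩,
    fun ⟨⟨_, ⟨θ⟩⟩, hs⟩ => ⟨A, θ.atomic hs, θ.isJoinComplete_atomic hs⟩⟩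

end Atoms

/-! ### The quasiequations and the sentence -/

open FirstOrder.Language

/-! ### Clauses as quasiequations and as quantifier-free formulas -/

section Clauses

variable {L : FirstOrder.Language.{0, 0}} {A : Type u} [L.Structure A]

/-- An implication from a list of equations to an equation, in four variables. -/
structure Clause (L : FirstOrder.Language.{0, 0}) : Type where
  premises : List (L.Term (Fin 4) × L.Term (Fin 4))
  conclusion : L.Term (Fin 4) × L.Term (Fin 4)

/-- Truth of a clause under an assignment. -/
def Clause.HoldsAt (q : Clause L) (v : Fin 4 → A) : Prop :=
  (∀ e ∈ q.premises, e.1.realize v = e.2.realize v) →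
    q.conclusion.1.realize v = q.conclusion.2.realize v

/-- A clause as a quasiequation. -/
def Clause.toQuasiequation (q : Clause L) : Quasiequation L where
  premises := q.premises.map fun e => (e.1.relabel Fin.val, e.2.relabel Fin.val)
  conclusion := (q.conclusion.1.relabel Fin.val, q.conclusion.2.relabel Fin.val)

lemma Clause.toQuasiequation_holds (q : Clause L) :
    q.toQuasiequation.Holds A ↔ ∀ v : Fin 4 → A, q.HoldsAt v := by
  have h : q.toQuasiequation.Holds A ↔ ∀ v : ℕ → A, q.HoldsAt (v ∘ Fin.val) := by
    simp only [Quasiequation.Holds, toQuasiequation, HoldsAt, List.forall_mem_map,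
      Term.realize_relabel]
  rw [h]
  refine ⟨fun h v => ?_, fun h v => h _⟩
  -- Any extension of the assignment to `ℕ` would do; this one repeats it modulo 4.
  have hv : (fun i => v (Fin.ofNat 4 i)) ∘ Fin.val = v := by
    funext i
    simp
  exact hv ▸ h fun i => v (Fin.ofNat 4 i)

/-- An equation in four variables as a formula in the first four of six bound variables. -/
def eqnFormula (e : L.Term (Fin 4) × L.Term (Fin 4)) : L.BoundedFormula Empty 6 :=
  (e.1.relabel (Sum.inr ∘ Fin.castAdd 2)).bdEqual (e.2.relabel (Sum.inr ∘ Fin.castAdd 2))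

/-- A clause as a formula in the first four of six bound variables. -/
def Clause.toFormula (q : Clause L) : L.BoundedFormula Empty 6 :=
  ((q.premises.map eqnFormula).foldr (· ⊓ ·) ⊤).imp (eqnFormula q.conclusion)

lemma realize_eqnFormula (e : L.Term (Fin 4) × L.Term (Fin 4)) (w : Empty → A) (xs : Fin 6 → A) :
    (eqnFormula e).Realize w xs ↔
      e.1.realize (xs ∘ Fin.castAdd 2) = e.2.realize (xs ∘ Fin.castAdd 2) := by
  rw [eqnFormula, BoundedFormula.realize_bdEqual, Term.realize_relabel, Term.realize_relabel]
  rfl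

lemma Clause.realize_toFormula (q : Clause L) (w : Empty → A) (xs : Fin 6 → A) :
    q.toFormula.Realize w xs ↔ q.HoldsAt (xs ∘ Fin.castAdd 2) := by
  simp only [toFormula, BoundedFormula.realize_imp, BoundedFormula.realize_foldr_inf,
    List.forall_mem_map, realize_eqnFormula, HoldsAt]

lemma isQF_foldr_inf {α : Type} {n : ℕ} (l : List (L.BoundedFormula α n))
    (h : ∀ φ ∈ l, φ.IsQF) : (l.foldr (· ⊓ ·) ⊤).IsQF := by
  induction l with
  | nil => exact BoundedFormula.IsQF.top
  | cons φ l ih =>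
    rw [List.forall_mem_cons] at h
    exact h.1.inf (ih h.2)

lemma isQF_eqnFormula (e : L.Term (Fin 4) × L.Term (Fin 4)) : (eqnFormula e).IsQF :=
  (BoundedFormula.IsAtomic.equal _ _).isQF

lemma Clause.isQF_toFormula (q : Clause L) : q.toFormula.IsQF :=
  (isQF_foldr_inf _ fun φ hφ => by
    obtain ⟨e, -, rfl⟩ := List.mem_map.mp hφ
    exact isQF_eqnFormula e).imp (isQF_eqnFormula _)

end Clauses

/-! ### The finite list of axioms and the ∀∃∀ sentence -/

section Axiomatisation

variable {σ : Set Op} (hσ : Op.antiRestrict ∈ σ) {A : Type u} [(lang σ).Structure A]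

/-- The term obtained by applying an operation symbol to two terms. -/
def opTerm {α : Type} {o : Op} (ho : o ∈ σ) (s t : (lang σ).Term α) : (lang σ).Term α :=
  (symb ho).apply₂ s t

/-- The domain restriction of two terms. -/
def drTerm {α : Type} (s t : (lang σ).Term α) : (lang σ).Term α :=
  opTerm hσ (opTerm hσ s t) t

@[simp] lemma realize_opTerm {α : Type} {o : Op} (ho : o ∈ σ) (s t : (lang σ).Term α)
    (v : α → A) : (opTerm ho s t).realize v = op ho (s.realize v) (t.realize v) :=
  Term.realize_functions_apply₂

@[simp] lemma realize_drTerm {α : Type} (s t : (lang σ).Term α) (v : α → A) :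
    (drTerm hσ s t).realize v = domRestrict hσ (s.realize v) (t.realize v) := by
  simp [drTerm, domRestrict]

open Classical in
/-- The axioms as a list of clauses. -/
noncomputable def clauses : List (Clause (lang σ)) :=
  let a : (lang σ).Term (Fin 4) := .var 0
  let b : (lang σ).Term (Fin 4) := .var 1
  let c : (lang σ).Term (Fin 4) := .var 2
  let d : (lang σ).Term (Fin 4) := .var 3
  let p : (lang σ).Term (Fin 4) → (lang σ).Term (Fin 4) → (lang σ).Term (Fin 4) := opTerm hσ
  let r : (lang σ).Term (Fin 4) → (lang σ).Term (Fin 4) → (lang σ).Term (Fin 4) := drTerm hσ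
  [⟨[], (p a a, p b b)⟩,
    ⟨[], (p a (p b b), p b b)⟩,
    ⟨[], (p a (p b a), p a a)⟩,
    ⟨[], (p (p a b) (p a c), p a (p b c))⟩,
    ⟨[], (p (p a b) (r (p a c) b), p b b)⟩,
    ⟨[], (r a a, a)⟩,
    ⟨[], (r (p a b) b, p a b)⟩,
    ⟨[], (r (r a b) c, r a (r b c))⟩,
    ⟨[], (r a (r b c), r b (r a c))⟩,
    ⟨[(r a c, r a d), (r (p a b) c, r (p a b) d)], (r b c, r b d)⟩,
    ⟨[(r a b, a), (r b a, b)], (a, b)⟩] ++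
  (if h : Op.inter ∈ σ then
    [⟨[], (r (opTerm h a b) a, opTerm h a b)⟩,
      ⟨[], (r (opTerm h a b) b, opTerm h a b)⟩,
      ⟨[(r c a, r c b)], (r c (opTerm h a b), r c a)⟩] else []) ++
  (if h : Op.update ∈ σ then
    [⟨[], (r b (opTerm h a b), r a b)⟩,
      ⟨[], (p b (opTerm h a b), p b a)⟩] else []) ++
  (if h : Op.prefUnion ∈ σ then
    [⟨[], (r a (opTerm h a b), a)⟩,
      ⟨[], (p a (opTerm h a b), p a b)⟩] else [])

lemma forall_mem_dite {α : Type} {P : α → Prop} {c : Prop} [Decidable c] {l : c → List α} :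
    (∀ x ∈ (if h : c then l h else []), P x) ↔ ∀ h : c, ∀ x ∈ l h, P x := by
  by_cases h : c <;> simp [h]

lemma forall_clauses_iff : (∀ q ∈ clauses hσ, ∀ v : Fin 4 → A, q.HoldsAt v) ↔ Axioms hσ A := by
  simp only [clauses, List.forall_mem_append, forall_mem_dite, List.forall_mem_cons,
    List.not_mem_nil, false_imp_iff, implies_true, and_true, Clause.HoldsAt, realize_opTerm,
    realize_drTerm, Term.realize_var, true_imp_iff, and_imp]
  constructor
  · rintro ⟨⟨⟨⟨h₁, h₂, h₃, h₄, h₅, h₆, h₇, h₈, h₉, h₁₀, h₁₁⟩, hi⟩, hu⟩, hp⟩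
    exact
      { zero := fun a b => h₁ ![a, b, a, a]
        anti_zero := fun a b => h₂ ![a, b, a, a]
        weaken := fun a b => h₃ ![a, b, a, a]
        distrib := fun a b c => h₄ ![a, b, c, a]
        peirce := fun a b c => h₅ ![a, b, c, a]
        idem := fun a => h₆ ![a, a, a, a]
        anti_le := fun a b => h₇ ![a, b, a, a]
        assoc := fun a b c => h₈ ![a, b, c, a]
        comm := fun a b c => h₉ ![a, b, c, a]
        locality := fun a b c d => h₁₀ ![a, b, c, d]
        antisymm := fun a b => h₁₁ ![a, b, a, a]
        inter_left := fun h a b => (hi h).1 ![a, b, a, a]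
        inter_right := fun h a b => (hi h).2.1 ![a, b, a, a]
        inter_agree := fun h a b c => (hi h).2.2 ![a, b, c, a]
        update_on := fun h a b => (hu h).1 ![a, b, a, a]
        update_off := fun h a b => (hu h).2 ![a, b, a, a]
        union_on := fun h a b => (hp h).1 ![a, b, a, a]
        union_off := fun h a b => (hp h).2 ![a, b, a, a] }
  · intro ax
    exact ⟨⟨⟨⟨fun _ => ax.zero _ _, fun _ => ax.anti_zero _ _, fun _ => ax.weaken _ _,
      fun _ => ax.distrib _ _ _, fun _ => ax.peirce _ _ _, fun _ => ax.idem _,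
      fun _ => ax.anti_le _ _, fun _ => ax.assoc _ _ _, fun _ => ax.comm _ _ _,
      fun _ => ax.locality _ _ _ _, fun _ => ax.antisymm _ _⟩,
      fun h => ⟨fun _ => ax.inter_left h _ _, fun _ => ax.inter_right h _ _,
        fun _ => ax.inter_agree h _ _ _⟩⟩,
      fun h => ⟨fun _ => ax.update_on h _ _, fun _ => ax.update_off h _ _⟩⟩,
      fun h => ⟨fun _ => ax.union_on h _ _, fun _ => ax.union_off h _ _⟩⟩

/-- The matrix of the separation of atoms: if the variable `0` is not below the variable `1` then
the variable `4` is nonzero, minimal with respect to the variable `5`, below the variable `0`, and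
not below the variable `1`. -/
def sepFormula : (lang σ).BoundedFormula Empty 6 :=
  let x : Fin 6 → (lang σ).Term (Empty ⊕ Fin 6) := fun i => .var (.inr i)
  let p : Fin 6 → (lang σ).Term (Empty ⊕ Fin 6) := fun i => opTerm hσ (x i) (x i)
  let le : Fin 6 → Fin 6 → (lang σ).BoundedFormula Empty 6 := fun i j =>
    (drTerm hσ (x i) (x j)).bdEqual (x i)
  (le 0 1).not.imp
    (((x 4).bdEqual (p 4)).not ⊓
      ((le 5 4).imp (((x 5).bdEqual (p 5)).not.imp ((x 5).bdEqual (x 4))) ⊓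
        (le 4 0 ⊓ (le 4 1).not)))

lemma isQF_sepFormula : (sepFormula hσ).IsQF := by
  have h : ∀ s t : (lang σ).Term (Empty ⊕ Fin 6), (s.bdEqual t).IsQF :=
    fun s t => (BoundedFormula.IsAtomic.equal s t).isQF
  exact (h _ _).not.imp ((h _ _).not.inf (((h _ _).imp ((h _ _).not.imp (h _ _))).inf
    ((h _ _).inf (h _ _).not)))

/-- The sentence stating the axioms and the separation of atoms. -/
noncomputable def sentence : (lang σ).Sentence :=
  -- Variables 0 to 3 are the outer universal block, shared by the clauses and the pair to be
  -- separated. Variable 4 is the atom, and variable 5 tests its minimality.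
  ((((clauses hσ).map Clause.toFormula).foldr (· ⊓ ·) ⊤ ⊓
    sepFormula hσ).all.ex).all.all.all.all

lemma isUnivExUniv_sentence : IsUnivExUniv (sentence hσ) := by
  refine .all (.all (.all (.all (.of_isExUniv (.ex (.of_isUniversal (.all (.of_isQF ?_))))))))
  refine .inf (isQF_foldr_inf _ fun φ hφ => ?_) (isQF_sepFormula hσ)
  obtain ⟨q, -, rfl⟩ := List.mem_map.mp hφ
  exact q.isQF_toFormula

lemma models_sentence_iff [Nonempty A] :
    A ⊨ sentence hσ ↔ Axioms hσ A ∧ AtomsSeparating hσ A := by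
  have key : A ⊨ sentence hσ ↔ ∀ a b a' b' : A, ∃ c, ∀ d,
      (∀ q ∈ clauses hσ, q.HoldsAt ![a, b, a', b']) ∧
        (¬ domRestrict hσ a b = a → c ≠ op hσ c c ∧
          (domRestrict hσ d c = d → d ≠ op hσ d d → d = c) ∧
          domRestrict hσ c a = c ∧ ¬ domRestrict hσ c b = c) := by
    simp only [sentence, Sentence.Realize, Formula.Realize, BoundedFormula.realize_all,
      BoundedFormula.realize_ex, BoundedFormula.realize_inf, BoundedFormula.realize_foldr_inf,
      List.forall_mem_map, Clause.realize_toFormula]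
    refine forall_congr' fun a => forall_congr' fun b => forall_congr' fun a' =>
      forall_congr' fun b' => exists_congr fun c => forall_congr' fun d => and_congr ?_ ?_
    · refine forall₂_congr fun q _ => Iff.of_eq (congrArg q.HoldsAt ?_)
      funext i
      fin_cases i <;> rfl
    · simp only [sepFormula, BoundedFormula.realize_imp, BoundedFormula.realize_not,
        BoundedFormula.realize_inf, BoundedFormula.realize_bdEqual, realize_opTerm,
        realize_drTerm, Term.realize_var, Sum.elim_inr]
      rfl
  rw [key, ← forall_clauses_iff]
  constructor
  · intro h
    refine ⟨fun q hq v => ?_, fun a b hab => ?_⟩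
    · obtain ⟨c, hc⟩ := h (v 0) (v 1) (v 2) (v 3)
      have hv : v = ![v 0, v 1, v 2, v 3] := by
        funext i
        fin_cases i <;> rfl
      exact hv ▸ (hc c).1 q hq
    · obtain ⟨c, hc⟩ := h a b a a
      have h' := fun d => (hc d).2 hab
      exact ⟨c, ⟨(h' c).1, fun d => (h' d).2.1⟩, (h' c).2.2⟩
  · rintro ⟨ax, hs⟩ a b a' b'
    by_cases hab : domRestrict hσ a b = a
    -- Nothing has to be separated here, so the existential witness is arbitrary.
    · exact ⟨a, fun d => ⟨fun q hq => ax q hq _, fun h => absurd hab h⟩⟩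
    · obtain ⟨c, hc, hca, hcb⟩ := hs a b hab
      exact ⟨c, fun d => ⟨fun q hq => ax q hq _, fun _ => ⟨hc.1, hc.2 d, hca, hcb⟩⟩⟩

end Axiomatisation

end PartialFunctionAlgebra

theorem mainTheorem2 (σ : Set PartialFunctionAlgebra.Op)
    (hσ : PartialFunctionAlgebra.Op.antiRestrict ∈ σ) :
    ∃ (Q : List (PartialFunctionAlgebra.Quasiequation (PartialFunctionAlgebra.lang σ)))
      (φ : (PartialFunctionAlgebra.lang σ).Sentence),
      PartialFunctionAlgebra.IsUnivExUniv φ ∧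
      ∀ (A : Type u) [Nonempty A] [(PartialFunctionAlgebra.lang σ).Structure A],
        (A ⊨ φ ↔ PartialFunctionAlgebra.MeetCompletelyRepresentable hσ A) ∧
        (PartialFunctionAlgebra.Op.inter ∈ σ →
          (A ⊨ φ ↔ PartialFunctionAlgebra.JoinCompletelyRepresentable hσ A)) ∧
        ((∀ q ∈ Q, q.Holds A) ↔ PartialFunctionAlgebra.Representable σ A) ∧
        (A ⊨ φ ↔ (∀ q ∈ Q, q.Holds A) ∧ PartialFunctionAlgebra.AtomsSeparating hσ A) := by
  open PartialFunctionAlgebra in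
  refine ⟨(clauses hσ).map Clause.toQuasiequation, sentence hσ, isUnivExUniv_sentence hσ, ?_⟩
  intro A _ _
  have hQ : (∀ q ∈ (clauses hσ).map Clause.toQuasiequation, q.Holds A) ↔ Axioms hσ A := by
    simp only [List.forall_mem_map, Clause.toQuasiequation_holds, forall_clauses_iff]
  rw [hQ, meetCompletelyRepresentable_iff, models_sentence_iff, axioms_iff_representable]
  exact ⟨Iff.rfl, fun hi => (joinCompletelyRepresentable_iff hσ hi).symm, Iff.rfl, Iff.rfl⟩
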